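/- Let $\mathcal X$ be a finite set and $\mathcal Y$ a finite abelian group (e.g. $\{0,1\}^n$ with XOR), and let $\ell\ge 0$. A *database* is a function $D:\mathcal X\to\mathcal Y\cup\{\bot\}$. The *compressed oracle* has an internal register $\mathbb C[\mathfrak D]=\bigotimes_{x\in\mathcal X}\mathbb C[\mathcal Y\cup\{\bot\}]$ spanned by the databases, starts with the empty database, and answers a query by the unitary $\mathsf{cO}=\mathsf{Comp}_x\,\mathsf O\,\mathsf{Comp}_x^\dagger$ (controlled by the query $x$), where $\mathsf O:|x\rangle|y\rangle|D\rangle\mapsto|x\rangle|y+D(x)\rangle|D\rangle$ (identity if $D(x)=\bot$), and $\mathsf{Comp}_x$ acts on the register holding $D(x)$ by $|y\rangle\mapsto|y\rangle+\frac{1}{\sqrt{|\mathcal Y|}}(|\bot\rangle-|\hat 0\rangle)$, $|\bot\rangle\mapsto|\hat 0\rangle=\frac{1}{\sqrt{|\mathcal Y|}}\sum_y|y\rangle$. 1. Let $\mathcal A$ be an oracle quantum algorithm that outputs $\mathbf x=(x_1,\dots,x_\ell)\in\mathcal X^\ell$ and $z\in\mathcal Z$, and let $\tilde{\mathcal A}$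 be the oracle algorithm that runs $\mathcal A$, makes $\ell$ classical queries on $x_1,\dots,x_\ell$ to obtain the answers $\mathbf y=(y_1,\dots,y_\ell)$, and outputs $(\mathbf x,\mathbf y,z)$. If $\tilde{\mathcal A}$ interacts with the compressed oracle, and at the end $D$ is obtained by measuring the internal state of the compressed oracle, then, for every output $(\mathbf x,\mathbf y,z)$ that occurs with non-zero probability, $$\Pr[\mathbf y=D(\mathbf x)\mid(\mathbf x,\mathbf y,z)]\ \ge\ 1-\frac{2\ell}{|\mathcal Y|}.$$ 2. More generally, let $\mathcal A$ be an oracle quantum algorithm with output $z\in\mathcal Z$, let $\mathcal F$ be a classical (possibly randomized) oracle algorithm making at most $\ell$ queries, and let $\tilde{\mathcal A}=\mathcal F\circ\mathcal A$ first run $\mathcal A$ to obtain $z$, then $\mathcal F$ to obtain $y:=\mathcal F^H(z)$, and output $(y,z)$. If $\tilde{\mathcal A}$ interacts with the compressed oracle and $D$ is obtained by measuring its internal state at the end, then, for every output $(y,z)$ that occurs with non-zero probability, $$\Pr[y=\mathcal F^D(z)\mid(y,z)]\ \ge\ 1-\frac{2\ell}{|\mathcal Y|},$$ where $\mathcal F^D(z)$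 is the output of $\mathcal F$, run on the same coins, when its queries $x$ are answered by $D(x)$; the event includes that the answer $\bot$ never occurs. 3. Let $R\subseteq\mathcal X^\ell\times\mathcal Y^\ell\times\mathcal Z$, and let $\mathcal A$ and $\tilde{\mathcal A}$ be as in 1. Let $p_\circ(\mathcal A)=\Pr[(\mathbf x,H(\mathbf x),z)\in R]$ and $p(\tilde{\mathcal A})=\Pr[\mathbf y=H(\mathbf x)\wedge(\mathbf x,\mathbf y,z)\in R]$ when $\mathcal A$, respectively $\tilde{\mathcal A}$, interacts with the standard oracle for a uniformly random $H:\mathcal X\to\mathcal Y$, and let $p'(\tilde{\mathcal A})=\Pr[\mathbf y=D(\mathbf x)\wedge(\mathbf x,\mathbf y,z)\in R]$ when $\tilde{\mathcal A}$ interacts with the compressed oracle and $D$ is obtained by measuring its internal state at the end. Then $$p_\circ(\mathcal A)=p(\tilde{\mathcal A})\ \le\ p'(\tilde{\mathcal A})+\frac{2\ell}{|\mathcal Y|},\qquad p'(\tilde{\mathcal A})\ \le\ \Pr[(\mathbf x,D(\mathbf x),z)\in R],$$ where the last probability is again for $\tilde{\mathcal A}$ interacting with the compressed oracle. -/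

import Mathlib

/-! ### Oracle quantum algorithms

`X` is the domain and `Y` the range of the random oracle. Finite-dimensional state spaces
`ℂ[S]` are functions `S → ℂ`, written in the computational basis. -/

/-- An oracle, possibly with an internal quantum register `ℂ[E]`: the initial state of that register
and the operator that answers a query, acting on query register `ℂ[X]`, response register `ℂ[Y]` and
internal register. Only the concrete oracles `standardOracle` and `compressedOracle` are used. -/
structure QOracle (X Y E : Type*) where
  init : E → ℂ
  query : Matrix (X × Y × E) (X × Y × E) ℂ

/-- A database: a function `X → Y ∪ {⊥}`, where `none` plays the role of `⊥`. -/
abbrev Database (X Y : Type*) := X → Option Y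

/-- An oracle quantum algorithm with output in `Z`. It has a query register `ℂ[X]`, a response
register `ℂ[Y]` and a work register of arbitrary finite dimension `dim`. It starts in an arbitrary
pure state, then performs the list `steps`, each entry `U` of which means
"make one oracle query and then apply the unitary `U`" (so `steps.length` is the number of queries),
and finally measures its registers in the computational basis; the output is a function `out` of
the measured basis state. -/
structure OracleAlg (X Y Z : Type*) [Fintype X] [DecidableEq X] [Fintype Y] [DecidableEq Y] where
  dim : ℕ
  init : X × Y × Fin dim → ℂ
  init_norm : ∑ s, ‖init s‖ ^ 2 = 1
  steps : List (Matrix.unitaryGroup (X × Y × Fin dim) ℂ)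
  out : X × Y × Fin dim → Z

/-- A classical deterministic oracle algorithm (after fixing its input): either stop with an output
`v`, or query the oracle at `x` and continue depending on the answer. -/
inductive QueryTree (X Y V : Type*) where
  | out (v : V) : QueryTree X Y V
  | query (x : X) (next : Y → QueryTree X Y V) : QueryTree X Y V

section
variable {X Y Z V V' E : Type*} [Fintype X] [DecidableEq X] [Fintype Y] [DecidableEq Y]
  [AddCommGroup Y] [Fintype E]

/-- Make a query: `O.query` acts on the query, response and oracle registers, and trivially on the
work register. -/
def QOracle.applyQuery (O : QOracle X Y E) {d : ℕ} (φ : X × Y × Fin d → E → ℂ) :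
    X × Y × Fin d → E → ℂ :=
  fun s e => ∑ t : X × Y × E, O.query (s.1, s.2.1, e) t * φ (t.1, t.2.1, s.2.2) t.2.2

/-- Apply an operator to the registers of the algorithm, and trivially to the oracle register. -/
def applyLocal {S : Type*} [Fintype S] (U : Matrix S S ℂ) (φ : S → E → ℂ) : S → E → ℂ :=
  fun s e => ∑ t, U s t * φ t e

/-- The joint state of the algorithm and the oracle when the algorithm's last operation
has been performed (before the output is measured). -/
def OracleAlg.finalState (A : OracleAlg X Y Z) (O : QOracle X Y E) : X × Y × Fin A.dim → E → ℂ :=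
  A.steps.foldl (fun φ U => applyLocal U.1 (O.applyQuery φ)) (fun s e => A.init s * O.init e)

open Classical in
/-- `Pr[ev z e]`, where `z` is the output of `A` interacting with `O`, and `e` is obtained by
measuring the internal state of `O` at the end. -/
noncomputable def OracleAlg.prob (A : OracleAlg X Y Z) (O : QOracle X Y E) (ev : Z → E → Prop) :
    ℝ :=
  ∑ s, ∑ e, if ev (A.out s) e then ‖A.finalState O s e‖ ^ 2 else 0

/-- The effect of a classical query `x` answered by `y` on the (subnormalized) oracle state: query
the oracle with `|x⟩` in the query register and `|0⟩` in the response register, and then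
measure the response register with result `y`. -/
def QOracle.classicalQuery (O : QOracle X Y E) (x : X) (y : Y) (φ : E → ℂ) : E → ℂ :=
  fun e => ∑ e', O.query (x, y, e) (x, 0, e') * φ e'

/-- The maximal number of queries made. -/
def QueryTree.depth : QueryTree X Y V → ℕ
  | .out _ => 0
  | .query _ k => (Finset.univ.sup fun y => (k y).depth) + 1

open Classical in
/-- `Pr[ev v e]` (weighted by the squared norm of `φ`), where `v` is the output of the classical
algorithm when it makes its queries to the oracle `O`, the register of which is initially in the
(subnormalized) state `φ`, and `e` is obtained by measuring the internal state of `O` at the end. -/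
noncomputable def QueryTree.prob (O : QOracle X Y E) :
    QueryTree X Y V → (E → ℂ) → (V → E → Prop) → ℝ
  | .out v, φ, ev => ∑ e, if ev v e then ‖φ e‖ ^ 2 else 0
  | .query x k, φ, ev => ∑ y, (k y).prob O (O.classicalQuery x y φ) ev

end

section
variable {X Y Z V V' : Type*}

/-- Apply a function to the output. -/
def QueryTree.map (f : V → V') : QueryTree X Y V → QueryTree X Y V'
  | .out v => .out (f v)
  | .query x k => .query x fun y => (k y).map f

/-- The output when every query `x` is answered by `D x`. It is `none` (undefined) if the value `⊥`
is ever encountered. -/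
def QueryTree.evalDB (D : Database X Y) : QueryTree X Y V → Option V
  | .out v => some v
  | .query x k => (D x).bind fun y => (k y).evalDB D

/-- Query `x₁, …, x_ℓ` one after the other, and output the `ℓ` answers. -/
def queryAll : {ℓ : ℕ} → (Fin ℓ → X) → QueryTree X Y (Fin ℓ → Y)
  | 0, _ => .out Fin.elim0
  | _ + 1, x => .query (x 0) fun y => (queryAll (Fin.tail x)).map (Fin.cons y)

end

/-- A classical, possibly randomized, oracle algorithm with input in `Z` and output in `V`: it draws
random coins `r` according to `law`, and then runs a deterministic classical oracle algorithm. -/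
structure ClassicalAlg (X Y Z V : Type*) where
  coins : ℕ
  law : PMF (Fin coins)
  tree : Fin coins → Z → QueryTree X Y V

/-- The classical algorithm that, given `(x, z)`, queries the points `x₁, …, x_ℓ`
and outputs the answers. -/
noncomputable def ClassicalAlg.queryPoints (X Y Z : Type*) (ℓ : ℕ) :
    ClassicalAlg X Y ((Fin ℓ → X) × Z) (Fin ℓ → Y) where
  coins := 1
  law := PMF.pure 0
  tree _ xz := queryAll xz.1

section
variable {X Y Z V E : Type*} [Fintype X] [DecidableEq X] [Fintype Y] [DecidableEq Y]
  [AddCommGroup Y] [Fintype E]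

/-- `Pr[ev r z v e]` for the algorithm `F ∘ A`, which first runs `A` to obtain `z`, then `F` on input
`z` with coins `r` to obtain `v`, all queries being answered by `O`, and which outputs `(v, z)`;
`e` is obtained by measuring the internal state of `O` at the end. -/
noncomputable def compProb (O : QOracle X Y E) (A : OracleAlg X Y Z) (F : ClassicalAlg X Y Z V)
    (ev : Fin F.coins → Z → V → E → Prop) : ℝ :=
  ∑ r, (F.law r).toReal * ∑ s, (F.tree r (A.out s)).prob O (A.finalState O s) (ev r (A.out s))

/-- The conditional probability `Pr[ev | cond]` for the algorithm `F ∘ A`. -/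
noncomputable def compCondProb (O : QOracle X Y E) (A : OracleAlg X Y Z) (F : ClassicalAlg X Y Z V)
    (ev cond : Fin F.coins → Z → V → E → Prop) : ℝ :=
  compProb O A F (fun r z v e => ev r z v e ∧ cond r z v e) / compProb O A F cond

end

/-! ### The oracles -/

section
variable (X Y : Type*) [Fintype X] [DecidableEq X] [Fintype Y] [DecidableEq Y] [AddCommGroup Y]

/-- The standard oracle for a fixed function `H`: `|x⟩|y⟩ ↦ |x⟩|y + H(x)⟩`. -/
def standardOracle {X Y : Type*} [DecidableEq X] [DecidableEq Y] [AddCommGroup Y] (H : X → Y) :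
    QOracle X Y Unit where
  init := fun _ => 1
  query := fun t s => if t.1 = s.1 ∧ t.2.1 = s.2.1 + H s.1 then 1 else 0

/-- The matrix of the unitary `Comp` on `ℂ[Y ∪ {⊥}]`, given by
`|y⟩ ↦ |y⟩ + (|⊥⟩ - |0̂⟩)/√|Y|` and `|⊥⟩ ↦ |0̂⟩`, where `|0̂⟩ = ∑ y, |y⟩/√|Y|`. -/
noncomputable def compMatrix : Matrix (Option Y) (Option Y) ℂ
  | some u, some v => (if u = v then 1 else 0) - 1 / (Fintype.card Y : ℂ)
  | none, some _ => 1 / (Real.sqrt (Fintype.card Y) : ℂ)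
  | some _, none => 1 / (Real.sqrt (Fintype.card Y) : ℂ)
  | none, none => 0

/-- `Comp` applied to the register `R_x` that holds the value `D(x)` of the database, controlled by
the content `x` of the query register. -/
noncomputable def compAtQuery : Matrix (X × Y × Database X Y) (X × Y × Database X Y) ℂ :=
  fun t s => if t.1 = s.1 ∧ t.2.1 = s.2.1 ∧ ∀ x, x ≠ s.1 → t.2.2 x = s.2.2 x
    then compMatrix Y (t.2.2 s.1) (s.2.2 s.1) else 0

/-- The purified oracle `|x⟩|y⟩|D⟩ ↦ |x⟩|y + D(x)⟩|D⟩`, extended by the identity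
to the case `D(x) = ⊥`. -/
def purifiedQuery : Matrix (X × Y × Database X Y) (X × Y × Database X Y) ℂ :=
  fun t s => if t.1 = s.1 ∧ t.2.1 = s.2.1 + (s.2.2 s.1).getD 0 ∧ t.2.2 = s.2.2 then 1 else 0

/-- The compressed oracle: it starts with the empty database `|⊥⟩` and answers queries by
`cO = Comp · O · Comp†`, with `Comp` acting on the register `R_x` at the queried point. -/
noncomputable def compressedOracle : QOracle X Y (Database X Y) where
  init := fun D => if D = fun _ => none then 1 else 0
  query := compAtQuery X Y * purifiedQuery X Y * (compAtQuery X Y).conjTranspose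

end

section
variable {X Y Z : Type*} [Fintype X] [DecidableEq X] [Fintype Y] [DecidableEq Y] [AddCommGroup Y]
  {ℓ : ℕ}

/-- `p_∘(A) = Pr[(x, H(x), z) ∈ R]`, where `A` outputs `(x, z)` after interacting with the standard
random oracle, initialized with a uniformly random `H`. -/
noncomputable def pCirc (A : OracleAlg X Y ((Fin ℓ → X) × Z))
    (R : Set ((Fin ℓ → X) × (Fin ℓ → Y) × Z)) : ℝ :=
  (∑ H : X → Y, A.prob (standardOracle H) fun xz _ => (xz.1, H ∘ xz.1, xz.2) ∈ R)
    / Fintype.card (X → Y)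

/-- `p(Ã) = Pr[y = H(x) ∧ (x, y, z) ∈ R]`, where `Ã` runs `A` to obtain `(x, z)`, makes classical
queries on `x₁, …, x_ℓ` to obtain `y`, and outputs `(x, y, z)`, interacting with the standard random
oracle, initialized with a uniformly random `H`. -/
noncomputable def pTilde (A : OracleAlg X Y ((Fin ℓ → X) × Z))
    (R : Set ((Fin ℓ → X) × (Fin ℓ → Y) × Z)) : ℝ :=
  (∑ H : X → Y, compProb (standardOracle H) A (ClassicalAlg.queryPoints X Y Z ℓ)
    fun _ xz y _ => y = H ∘ xz.1 ∧ (xz.1, y, xz.2) ∈ R) / Fintype.card (X → Y)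

/-- `p'(Ã) = Pr[y = D(x) ∧ (x, y, z) ∈ R]`, where `Ã` interacts with the compressed oracle and `D` is
obtained by measuring the internal state of the compressed oracle at the end. -/
noncomputable def pPrimeTilde (A : OracleAlg X Y ((Fin ℓ → X) × Z))
    (R : Set ((Fin ℓ → X) × (Fin ℓ → Y) × Z)) : ℝ :=
  compProb (compressedOracle X Y) A (ClassicalAlg.queryPoints X Y Z ℓ)
    fun _ xz y D => (∀ i, D (xz.1 i) = some (y i)) ∧ (xz.1, y, xz.2) ∈ R

/-- `Pr[(x, D(x), z) ∈ R]`, where `Ã` interacts with the compressed oracle; the event includes that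
`D(x_i) ≠ ⊥` for all `i`. -/
noncomputable def pDatabase (A : OracleAlg X Y ((Fin ℓ → X) × Z))
    (R : Set ((Fin ℓ → X) × (Fin ℓ → Y) × Z)) : ℝ :=
  compProb (compressedOracle X Y) A (ClassicalAlg.queryPoints X Y Z ℓ)
    fun _ xz _ D => ∃ u : Fin ℓ → Y, (∀ i, D (xz.1 i) = some (u i)) ∧ (xz.1, u, xz.2) ∈ R

end

/-! Replace the random oracle by its purification, the uniform superposition of all `H : X → Y`. The
map `compress`, which applies `Comp` to every register, is an isometry, sends the uniform
superposition to the empty database, and intertwines queries to the purified oracle with queries to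
the compressed one (`sum_compMatrix_compress`). Hence the joint state with the compressed oracle is
always the compression of a superposition of ordinary runs, one for each `H`
(`OracleAlg.finalState_compressedOracle`).

In this picture a classical query at `x` answered by `y` just deletes the branches with `H x ≠ y`.
After the classical queries, all surviving `H` agree on the set `S` of queried points, so the
compressed registers in `S` are in the product state of the vectors `Comp |y_x⟩`. Measuring such a
register gives `y_x` with probability `(1 - 1/|Y|)^2`, independently of the rest, so the database is
consistent with probability exactly `(1 - 1/|Y|)^(2|S|)` (`sum_norm_sq_compress_agree`). As `S` has
at most `ℓ` points, Bernoulli's inequality gives the bound, run by run (`QueryTree.le_prob_evalDB`),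
hence also after summing over coins and measured outputs.

For the success probabilities, the isometry shows that events which ignore the database are equally
likely for both oracles; the relative loss becomes an additive one because probabilities are at most
1. -/

/-! ### The single-register unitary `Comp` -/

-- `Comp` swaps `|⊥⟩` with `|0̂⟩` and fixes the orthogonal complement of their span, so it is an
-- involution.
open Finset in
theorem compMatrix_mul_self (Y : Type*) [Fintype Y] [DecidableEq Y] [Nonempty Y] :
    compMatrix Y * compMatrix Y = 1 := by
  have hN : (Fintype.card Y : ℂ) ≠ 0 := Nat.cast_ne_zero.mpr Fintype.card_ne_zero
  have hs : ((Real.sqrt (Fintype.card Y) : ℝ) : ℂ) * (Real.sqrt (Fintype.card Y) : ℝ) =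
      Fintype.card Y := by
    rw [← Complex.ofReal_mul, Real.mul_self_sqrt (Nat.cast_nonneg _)]
    simp
  have hs0 : ((Real.sqrt (Fintype.card Y) : ℝ) : ℂ) ≠ 0 := by
    intro h
    rw [h, zero_mul] at hs
    exact hN hs.symm
  ext a b
  rw [Matrix.mul_apply, Fintype.sum_option]
  cases a <;> cases b
  · simp only [compMatrix, sum_const, card_univ, nsmul_eq_mul, Matrix.one_apply_eq]
    rw [zero_mul, zero_add, div_mul_div_comm, hs, one_mul, mul_one_div, div_self hN]
  · simp only [compMatrix, mul_sub, sum_sub_distrib, sum_const, card_univ, nsmul_eq_mul,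
      mul_ite, mul_one, mul_zero, sum_ite_eq', mem_univ, if_true, ne_eq, reduceCtorEq,
      not_false_eq_true, Matrix.one_apply_ne]
    field_simp
    ring
  · simp only [compMatrix, sub_mul, sum_sub_distrib, sum_const, card_univ, nsmul_eq_mul,
      ite_mul, one_mul, zero_mul, sum_ite_eq, mem_univ, if_true, ne_eq, reduceCtorEq,
      not_false_eq_true, Matrix.one_apply_ne]
    field_simp
    ring
  · rename_i u v
    simp only [compMatrix, sub_mul, mul_sub, sum_sub_distrib, sum_const, card_univ, nsmul_eq_mul,
      ite_mul, mul_ite, mul_one, one_mul, mul_zero, zero_mul, sum_ite_eq, sum_ite_eq', mem_univ,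
      if_true, Matrix.one_apply, Option.some_inj]
    have : (1 : ℂ) / (Real.sqrt (Fintype.card Y) : ℝ) * (1 / (Real.sqrt (Fintype.card Y) : ℝ)) =
        1 / Fintype.card Y := by
      rw [div_mul_div_comm, hs, one_mul]
    rw [this]
    field_simp
    ring

theorem compMatrix_comm {Y : Type*} [Fintype Y] [DecidableEq Y] (a b : Option Y) :
    compMatrix Y a b = compMatrix Y b a := by
  cases a <;> cases b <;> simp [compMatrix, eq_comm]

theorem star_compMatrix {Y : Type*} [Fintype Y] [DecidableEq Y] (a b : Option Y) :
    star (compMatrix Y a b) = compMatrix Y a b := by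
  cases a <;> cases b <;> simp [compMatrix, apply_ite]

theorem sum_compMatrix_mul_compMatrix {Y : Type*} [Fintype Y] [DecidableEq Y] [Nonempty Y]
    (a b : Option Y) :
    ∑ o, compMatrix Y a o * compMatrix Y o b = if a = b then 1 else 0 := by
  rw [← Matrix.mul_apply, compMatrix_mul_self, Matrix.one_apply]

/-- The vector `|0̂⟩` is the `⊥` column of `Comp`, so the involution property sends it back to
`|⊥⟩`. -/
theorem sum_compMatrix_some {Y : Type*} [Fintype Y] [DecidableEq Y] [Nonempty Y] (o : Option Y) :
    ∑ u, compMatrix Y o (some u) * (1 / (Real.sqrt (Fintype.card Y) : ℂ)) =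
      if o = none then 1 else 0 := by
  rw [← sum_compMatrix_mul_compMatrix, Fintype.sum_option]
  simp [compMatrix]

/-! ### The compression map and the statistics of the measured database -/

section
variable {X Y : Type*} [Fintype X] [DecidableEq X] [Fintype Y] [DecidableEq Y]

/-- A sum over the functions that agree with `D` off `x` is a sum over the value at `x`. -/
theorem sum_ite_agree_off {β : Type*} [Fintype β] [DecidableEq β] {M : Type*} [AddCommMonoid M]
    (D : X → β) (x : X) (f : (X → β) → M) :
    (∑ D' : X → β, if ∀ x', x' ≠ x → D x' = D' x' then f D' else 0) =
      ∑ o, f (Function.update D x o) := by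
  rw [← Finset.sum_filter]
  symm
  refine Finset.sum_bij (fun o _ => Function.update D x o) ?_ ?_ ?_ ?_
  · intro o _
    simp only [Finset.mem_filter, Finset.mem_univ, true_and]
    intro x' hx'
    rw [Function.update_of_ne hx']
  · intro o _ o' _ h
    simpa using congrFun h x
  · intro D' hD'
    simp only [Finset.mem_filter, Finset.mem_univ, true_and] at hD'
    refine ⟨D' x, Finset.mem_univ _, ?_⟩
    ext1 x'
    by_cases h : x' = x
    · subst h; simp
    · rw [Function.update_of_ne h, hD' x' h]
  · intros; rfl

theorem compAtQuery_mulVec (v : X × Y × Database X Y → ℂ) (x : X) (y : Y) (D : Database X Y) :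
    (compAtQuery X Y).mulVec v (x, y, D) =
      ∑ o, compMatrix Y (D x) o * v (x, y, Function.update D x o) := by
  simp only [Matrix.mulVec, dotProduct, Fintype.sum_prod_type, compAtQuery]
  rw [Finset.sum_eq_single x (by intro x' _ h; simp [h.symm]) (by simp),
    Finset.sum_eq_single y (by intro x' _ h; simp [h.symm]) (by simp)]
  simp only [true_and, ite_mul, zero_mul]
  rw [sum_ite_agree_off D x (fun D' => compMatrix Y (D x) (D' x) * v (x, y, D'))]
  simp

theorem compAtQuery_conjTranspose : (compAtQuery X Y).conjTranspose = compAtQuery X Y := by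
  ext ⟨x, y, D⟩ ⟨x', y', D'⟩
  rw [Matrix.conjTranspose_apply]
  simp only [compAtQuery]
  rw [apply_ite star, star_compMatrix, star_zero, compMatrix_comm]
  by_cases h : x = x'
  · subst h
    simp only [true_and, eq_comm]
  · rw [if_neg (fun h' => h h'.1.symm), if_neg (fun h' => h h'.1)]

/-- The compression map: it applies `Comp` to every register of the purified random oracle, that is,
of a superposition of functions `H : X → Y`. -/
noncomputable def compress (ψ : (X → Y) → ℂ) (D : Database X Y) : ℂ :=
  ∑ H : X → Y, (∏ x, compMatrix Y (D x) (some (H x))) * ψ H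

theorem prod_compMatrix_update (D : Database X Y) (x : X) (o : Option Y) (H : X → Y) :
    ∏ x', compMatrix Y (Function.update D x o x') (some (H x')) =
      compMatrix Y o (some (H x)) *
        ∏ x' ∈ Finset.univ.erase x, compMatrix Y (D x') (some (H x')) := by
  rw [← Finset.mul_prod_erase _ _ (Finset.mem_univ x), Function.update_self]
  congr 1
  refine Finset.prod_congr rfl fun x' hx' => ?_
  rw [Function.update_of_ne (Finset.ne_of_mem_erase hx')]

/-- Uncompressing the register at `x`, acting on it diagonally and compressing it again, amounts to
the diagonal action on the purified random oracle. -/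
theorem sum_compMatrix_compress [Nonempty Y] (f : Option Y → (X → Y) → ℂ) (x : X) (D : Database X Y) :
    ∑ o, compMatrix Y (D x) o *
        ∑ o', compMatrix Y o o' * compress (f o) (Function.update D x o') =
      compress (fun H => f (some (H x)) H) D := by
  -- The second `Comp` at `x` cancels the one inside `compress`, leaving the basis value `H x` in
  -- that register. Its `⊥` component vanishes, so `f none` is irrelevant.
  have h1 (o : Option Y) : ∑ o', compMatrix Y o o' * compress (f o) (Function.update D x o') =
      ∑ H : X → Y, if o = some (H x) then
        (∏ x' ∈ Finset.univ.erase x, compMatrix Y (D x') (some (H x'))) * f o H else 0 := by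
    simp only [compress, Finset.mul_sum, prod_compMatrix_update]
    rw [Finset.sum_comm]
    refine Finset.sum_congr rfl fun H _ => ?_
    have := sum_compMatrix_mul_compMatrix o (some (H x))
    calc _ = (∑ o', compMatrix Y o o' * compMatrix Y o' (some (H x))) *
          ((∏ x' ∈ Finset.univ.erase x, compMatrix Y (D x') (some (H x'))) * f o H) := by
          rw [Finset.sum_mul]
          exact Finset.sum_congr rfl fun o' _ => by ring
      _ = _ := by rw [this, ite_mul, one_mul, zero_mul]
  simp only [h1, Finset.mul_sum, mul_ite, mul_zero]
  rw [Finset.sum_comm, compress]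
  refine Finset.sum_congr rfl fun H _ => ?_
  rw [Finset.sum_ite_eq' Finset.univ (some (H x)) (fun o => compMatrix Y (D x) o *
    ((∏ x' ∈ Finset.univ.erase x, compMatrix Y (D x') (some (H x'))) * f o H)),
    if_pos (Finset.mem_univ _), ← mul_assoc, Finset.mul_prod_erase _ (fun x' => compMatrix Y (D x')
      (some (H x'))) (Finset.mem_univ x)]

/-- The columns of a real symmetric involution are orthonormal, and the inner product of tensor
products factorizes over the registers. This is the isometry property of `compress` on basis
vectors. -/
theorem sum_prod_compMatrix_mul [Nonempty Y] (H H' : X → Y) :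
    ∑ D : Database X Y, (∏ x, compMatrix Y (D x) (some (H x))) *
        ∏ x, compMatrix Y (D x) (some (H' x)) = if H = H' then 1 else 0 := by
  simp only [← Finset.prod_mul_distrib]
  rw [← Fintype.prod_sum (fun x o => compMatrix Y o (some (H x)) * compMatrix Y o (some (H' x)))]
  have (x : X) : ∑ o, compMatrix Y o (some (H x)) * compMatrix Y o (some (H' x)) =
      if H x = H' x then 1 else 0 := by
    simp only [compMatrix_comm _ (some (H x)), sum_compMatrix_mul_compMatrix, Option.some_inj]
  simp only [this, Fintype.prod_ite_zero, Finset.prod_const_one, funext_iff]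

theorem sum_norm_sq_compress [Nonempty Y] (ψ : (X → Y) → ℂ) :
    ∑ D, ‖compress ψ D‖ ^ 2 = ∑ H, ‖ψ H‖ ^ 2 := by
  have key (z : ℂ) : ((‖z‖ ^ 2 : ℝ) : ℂ) = star z * z := by
    rw [← Complex.normSq_eq_norm_sq, Complex.normSq_eq_conj_mul_self]
    rfl
  apply Complex.ofReal_injective
  rw [Complex.ofReal_sum, Complex.ofReal_sum]
  simp only [key, compress, star_sum, star_mul', star_prod, star_compMatrix, Finset.sum_mul_sum]
  rw [Finset.sum_comm]
  refine Finset.sum_congr rfl fun H _ => ?_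
  rw [Finset.sum_comm]
  calc _ = ∑ H', (∑ D : Database X Y, (∏ x, compMatrix Y (D x) (some (H x))) *
        ∏ x, compMatrix Y (D x) (some (H' x))) * (star (ψ H) * ψ H') := by
        refine Finset.sum_congr rfl fun H' _ => ?_
        rw [Finset.sum_mul]
        exact Finset.sum_congr rfl fun D _ => by ring
    _ = _ := by simp [sum_prod_compMatrix_mul]

/-- If the purified random oracle assigns `y` to `x`, then the compressed oracle is in a product
state, with the register at `x` in state `Comp |y⟩`. -/
theorem compress_update_of_support {ψ : (X → Y) → ℂ} {x : X} {y : Y}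
    (hψ : ∀ H, H x ≠ y → ψ H = 0) (D : Database X Y) :
    ∃ g : ℂ, ∀ o, compress ψ (Function.update D x o) = compMatrix Y o (some y) * g := by
  refine ⟨∑ H : X → Y, (∏ x' ∈ Finset.univ.erase x, compMatrix Y (D x') (some (H x'))) * ψ H,
    fun o => ?_⟩
  rw [Finset.mul_sum, compress]
  refine Finset.sum_congr rfl fun H _ => ?_
  by_cases h : H x = y
  · rw [prod_compMatrix_update, h, mul_assoc]
  · rw [hψ H h]; simp
open Classical in
/-- If the purified random oracle assigns `y` to `x`, then the database contains `(x, y)` with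
probability `(1 - 1 / |Y|) ^ 2`, independently of the other registers. -/
theorem sum_norm_sq_compress_eq_at [Nonempty Y] {ψ : (X → Y) → ℂ} {x : X} {y : Y}
    (hψ : ∀ H, H x ≠ y → ψ H = 0) (ev : Database X Y → Prop)
    (hev : ∀ D o, ev (Function.update D x o) ↔ ev D) :
    (∑ D, if D x = some y ∧ ev D then ‖compress ψ D‖ ^ 2 else 0) =
      (1 - 1 / (Fintype.card Y : ℝ)) ^ 2 * ∑ D, if ev D then ‖compress ψ D‖ ^ 2 else 0 := by
  have hdiag : ‖compMatrix Y (some y) (some y)‖ ^ 2 = (1 - 1 / (Fintype.card Y : ℝ)) ^ 2 := by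
    have : compMatrix Y (some y) (some y) = ((1 - 1 / (Fintype.card Y : ℝ) : ℝ) : ℂ) := by
      simp [compMatrix]
    rw [this, Complex.norm_real, Real.norm_eq_abs, sq_abs]
  have hcol : ∑ o, ‖compMatrix Y o (some y)‖ ^ 2 = 1 := by
    have h := sum_compMatrix_mul_compMatrix (some y) (some y)
    rw [if_pos rfl] at h
    apply Complex.ofReal_injective
    rw [Complex.ofReal_sum, Complex.ofReal_one, ← h]
    refine Finset.sum_congr rfl fun o _ => ?_
    rw [← Complex.normSq_eq_norm_sq, Complex.normSq_eq_conj_mul_self, compMatrix_comm (some y) o]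
    exact congrArg (· * _) (star_compMatrix o (some y))
  -- Split a database into its value at `x` and the rest `d`. For each `d` the claim compares one
  -- squared entry of the column `Comp |y⟩` with the squared norm 1 of the whole column.
  rw [← (Equiv.funSplitAt x (Option Y)).symm.sum_comp,
    ← (Equiv.funSplitAt x (Option Y)).symm.sum_comp, Fintype.sum_prod_type_right,
    Fintype.sum_prod_type_right, Finset.mul_sum]
  refine Finset.sum_congr rfl fun d _ => ?_
  set D₀ : Database X Y := (Equiv.funSplitAt x (Option Y)).symm (none, d)
  have hD (o : Option Y) :
      (Equiv.funSplitAt x (Option Y)).symm (o, d) = Function.update D₀ x o := by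
    ext1 x'
    by_cases h : x' = x
    · subst h; simp
    · simp [D₀, h, Equiv.funSplitAt, Equiv.piSplitAt]
  obtain ⟨g, hg⟩ := compress_update_of_support hψ D₀
  simp only [hD, hg, hev, Function.update_self, norm_mul, mul_pow]
  by_cases h : ev D₀
  · simp only [h, and_true, if_true, Finset.sum_ite_eq', Finset.mem_univ, hdiag]
    rw [← Finset.sum_mul, hcol, one_mul]
  · simp [h]

open Classical in
/-- If the purified random oracle agrees with `a` on `S`, then so does the database with probability
`(1 - 1 / |Y|) ^ (2 * |S|)`. -/
theorem sum_norm_sq_compress_agree [Nonempty Y] (a : X → Y) (S : Finset X) {ψ : (X → Y) → ℂ}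
    (hψ : ∀ H, (∃ x ∈ S, H x ≠ a x) → ψ H = 0) :
    (∑ D, if ∀ x ∈ S, D x = some (a x) then ‖compress ψ D‖ ^ 2 else 0) =
      (1 - 1 / (Fintype.card Y : ℝ)) ^ (2 * S.card) * ∑ H, ‖ψ H‖ ^ 2 := by
  induction S using Finset.induction_on with
  | empty => simp [sum_norm_sq_compress]
  | insert x S hx ih =>
    have key := sum_norm_sq_compress_eq_at
      (fun H h => hψ H ⟨x, Finset.mem_insert_self _ _, h⟩)
      (fun D => ∀ x' ∈ S, D x' = some (a x')) ?_
    · refine Eq.trans ?_ (key.trans ?_)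
      · refine Finset.sum_congr rfl fun D _ => ?_
        simp only [Finset.forall_mem_insert]
        congr
      have ih' := ih fun H ⟨x', h, h'⟩ => hψ H ⟨x', Finset.mem_insert_of_mem h, h'⟩
      rw [Finset.card_insert_of_notMem hx, mul_add, mul_one, pow_add, mul_comm (_ ^ _) (_ ^ 2),
        mul_assoc, ← ih']
      congr!
    · intro D o
      refine forall₂_congr fun x' hx' => ?_
      rw [Function.update_of_ne (ne_of_mem_of_not_mem hx' hx)]


/-! ### Oracle queries seen through the compression map -/

variable [AddCommGroup Y]

theorem purifiedQuery_mulVec (v : X × Y × Database X Y → ℂ) (x : X) (y : Y) (D : Database X Y) :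
    (purifiedQuery X Y).mulVec v (x, y, D) = v (x, y - (D x).getD 0, D) := by
  simp only [Matrix.mulVec, dotProduct, Fintype.sum_prod_type, purifiedQuery]
  rw [Finset.sum_eq_single x (by intro x' _ h; simp [h.symm]) (by simp),
    Finset.sum_eq_single (y - (D x).getD 0) _ (by simp),
    Finset.sum_eq_single D (by intro x' _ h; simp [h.symm]) (by simp)]
  · simp
  · intro y' _ h
    refine Finset.sum_eq_zero fun D' _ => ?_
    rw [if_neg, zero_mul]
    rintro ⟨-, h1, h2⟩
    subst h2
    exact h (by rw [h1, add_sub_cancel_right])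

theorem compressedOracle_query_mulVec (v : X × Y × Database X Y → ℂ) (x : X) (y : Y)
    (D : Database X Y) :
    (compressedOracle X Y).query.mulVec v (x, y, D) =
      ∑ o, compMatrix Y (D x) o *
        ∑ o', compMatrix Y o o' * v (x, y - o.getD 0, Function.update D x o') := by
  simp only [compressedOracle, ← Matrix.mulVec_mulVec, compAtQuery_conjTranspose]
  rw [compAtQuery_mulVec]
  refine Finset.sum_congr rfl fun o _ => ?_
  rw [purifiedQuery_mulVec, compAtQuery_mulVec]
  simp

theorem standardOracle_applyQuery (H : X → Y) {d : ℕ} (φ : X × Y × Fin d → Unit → ℂ)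
    (s : X × Y × Fin d) (e : Unit) :
    (standardOracle H).applyQuery φ s e = φ (s.1, s.2.1 - H s.1, s.2.2) e := by
  obtain ⟨x, y, w⟩ := s
  simp only [QOracle.applyQuery, standardOracle, Fintype.sum_prod_type]
  rw [Finset.sum_eq_single x (by intro x' _ h; simp [h.symm]) (by simp),
    Finset.sum_eq_single (y - H x) _ (by simp)]
  · simp
  · intro y' _ h
    simp only [Finset.univ_unique, Finset.sum_singleton]
    rw [if_neg, zero_mul]
    rintro ⟨-, h1⟩
    exact h (by rw [h1, add_sub_cancel_right])

/-- Between the two `Comp` operations the query is controlled by the uncompressed value `o = some (H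
x)`, so it shifts the response by `H x` in each branch. -/
theorem compressedOracle_applyQuery {d : ℕ} (ψ : (X → Y) → X × Y × Fin d → Unit → ℂ) :
    (compressedOracle X Y).applyQuery (fun s => compress fun H => ψ H s ()) =
      fun s => compress fun H => (standardOracle H).applyQuery (ψ H) s () := by
  funext ⟨x, y, w⟩ D
  have := compressedOracle_query_mulVec
    (fun t => compress (fun H => ψ H (t.1, t.2.1, w) ()) t.2.2) x y D
  simp only [QOracle.applyQuery]
  simp only [Matrix.mulVec, dotProduct] at this
  rw [this, sum_compMatrix_compress (fun o H => ψ H (x, y - o.getD 0, w) ())]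
  congr 1
  funext H
  exact (standardOracle_applyQuery H (ψ H) (x, y, w) ()).symm

theorem compressedOracle_classicalQuery (x : X) (y : Y) (ψ : (X → Y) → ℂ) :
    (compressedOracle X Y).classicalQuery x y (compress ψ) =
      compress fun H => if H x = y then ψ H else 0 := by
  funext D
  have := compressedOracle_query_mulVec
    (fun t => if t.1 = x ∧ t.2.1 = 0 then compress ψ t.2.2 else 0) x y D
  simp only [Matrix.mulVec, dotProduct] at this
  have h2 : (compressedOracle X Y).classicalQuery x y (compress ψ) D =
      ∑ t, (compressedOracle X Y).query (x, y, D) t *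
        if t.1 = x ∧ t.2.1 = 0 then compress ψ t.2.2 else 0 := by
    rw [Fintype.sum_prod_type, Finset.sum_eq_single x (by intro x' _ h; simp [h]) (by simp),
      Fintype.sum_prod_type, Finset.sum_eq_single 0 (by intro x' _ h; simp [h]) (by simp)]
    simp [QOracle.classicalQuery]
  -- The response register starts at `0`, so reading `y` forces the uncompressed value to be `y`.
  -- The default `0` for `⊥` is harmless because `⊥` has no amplitude there.
  have h3 (o : Option Y) (D' : Database X Y) :
      (if y - o.getD 0 = 0 then compress ψ D' else 0) =
        compress (fun H => if o.getD 0 = y then ψ H else 0) D' := by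
    simp only [sub_eq_zero, eq_comm (a := y)]
    split_ifs
    · rfl
    · simp [compress]
  rw [h2, this]
  simp only [true_and, h3]
  rw [sum_compMatrix_compress (fun o H => if o.getD 0 = y then ψ H else 0)]
  rfl

omit [Fintype X] [Fintype Y] in
theorem standardOracle_classicalQuery (H : X → Y) (x : X) (y : Y) (φ : Unit → ℂ) :
    (standardOracle H).classicalQuery x y φ = fun e => if H x = y then φ e else 0 := by
  funext e
  simp [QOracle.classicalQuery, standardOracle, eq_comm]
end

/-! ### Classical algorithms as query trees -/

section
variable {X Y Z V V' E : Type*}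

/-- The output when every query `x` is answered by `H x`. -/
def QueryTree.eval (H : X → Y) : QueryTree X Y V → V
  | .out v => v
  | .query x k => (k (H x)).eval H

theorem QueryTree.eval_map (H : X → Y) (f : V → V') (t : QueryTree X Y V) :
    (t.map f).eval H = f (t.eval H) := by
  induction t with
  | out v => rfl
  | query x k ih => exact ih (H x)

theorem QueryTree.evalDB_map (D : Database X Y) (f : V → V') (t : QueryTree X Y V) :
    (t.map f).evalDB D = (t.evalDB D).map f := by
  induction t with
  | out v => rfl
  | query x k ih =>
    simp only [QueryTree.map, QueryTree.evalDB]
    cases D x with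
    | none => rfl
    | some y => exact ih y

theorem eval_queryAll (H : X → Y) {ℓ : ℕ} (x : Fin ℓ → X) :
    (queryAll x).eval H = H ∘ x := by
  induction ℓ with
  | zero => exact Subsingleton.elim _ _
  | succ ℓ ih =>
    simp only [queryAll, QueryTree.eval, QueryTree.eval_map, ih]
    funext i
    refine Fin.cases ?_ (fun j => ?_) i <;> simp [Fin.tail]

/-- This makes the claim about `ℓ` fixed query points an instance of the claim about arbitrary
classical algorithms. -/
theorem evalDB_queryAll (D : Database X Y) {ℓ : ℕ} (x : Fin ℓ → X) (y : Fin ℓ → Y) :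
    (queryAll x).evalDB D = some y ↔ ∀ i, D (x i) = some (y i) := by
  induction ℓ with
  | zero => simpa [queryAll, QueryTree.evalDB] using Subsingleton.elim _ _
  | succ ℓ ih =>
    simp only [queryAll, QueryTree.evalDB, QueryTree.evalDB_map, Fin.forall_fin_succ]
    cases h : D (x 0) with
    | none => simp
    | some u =>
      simp only [Option.bind_some, Option.map_eq_some_iff, Option.some_inj]
      constructor
      · rintro ⟨y', h1, rfl⟩
        exact ⟨rfl, (ih _ _).1 h1⟩
      · rintro ⟨rfl, h2⟩
        exact ⟨Fin.tail y, (ih _ _).2 h2, Fin.cons_self_tail y⟩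

variable [Fintype Y]

theorem QueryTree.depth_map (f : V → V') (t : QueryTree X Y V) :
    (t.map f).depth = t.depth := by
  induction t with
  | out v => rfl
  | query x k ih => simp only [QueryTree.map, QueryTree.depth, ih]

theorem depth_queryAll_le {ℓ : ℕ} (x : Fin ℓ → X) : (queryAll (Y := Y) x).depth ≤ ℓ := by
  induction ℓ with
  | zero => exact le_rfl
  | succ ℓ ih =>
    simp only [queryAll, QueryTree.depth, QueryTree.depth_map]
    exact Nat.succ_le_succ (Finset.sup_le fun _ _ => ih _)

theorem QueryTree.depth_lt (x : X) (k : Y → QueryTree X Y V) (y : Y) :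
    (k y).depth + 1 ≤ (QueryTree.query x k).depth := by
  simp only [QueryTree.depth]
  exact Nat.succ_le_succ (Finset.le_sup (f := fun y => (k y).depth) (Finset.mem_univ y))

/-! ### Output probabilities of classical runs -/

variable [AddCommGroup Y] [Fintype E]

theorem QueryTree.prob_nonneg (O : QOracle X Y E) (t : QueryTree X Y V) (φ : E → ℂ)
    (ev : V → E → Prop) : 0 ≤ t.prob O φ ev := by
  induction t generalizing φ with
  | out v => exact Finset.sum_nonneg fun e _ => by split_ifs <;> positivity
  | query x k ih => exact Finset.sum_nonneg fun y _ => ih y _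

theorem QueryTree.prob_mono (O : QOracle X Y E) (t : QueryTree X Y V) (φ : E → ℂ)
    {ev ev' : V → E → Prop} (h : ∀ v e, ev v e → ev' v e) : t.prob O φ ev ≤ t.prob O φ ev' := by
  induction t generalizing φ with
  | out v =>
    refine Finset.sum_le_sum fun e _ => ?_
    by_cases h1 : ev v e
    · rw [if_pos h1, if_pos (h _ _ h1)]
    · rw [if_neg h1]; split_ifs <;> positivity
  | query x k ih => exact Finset.sum_le_sum fun y _ => ih y _

variable [Fintype X] [DecidableEq X] [DecidableEq Y]

open Classical in
omit [Fintype X] in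
theorem QueryTree.prob_standardOracle (H : X → Y) (t : QueryTree X Y V) (φ : Unit → ℂ)
    (ev : V → Unit → Prop) :
    t.prob (standardOracle H) φ ev = if ev (t.eval H) () then ‖φ ()‖ ^ 2 else 0 := by
  induction t generalizing φ with
  | out v => exact Fintype.sum_unique _
  | query x k ih =>
    simp only [QueryTree.prob, ih, standardOracle_classicalQuery]
    refine (Finset.sum_eq_single (H x) (by intro y _ h; simp [h.symm]) (by simp)).trans ?_
    rw [if_pos rfl]
    rfl

-- Each `H` survives in exactly one branch, the one labelled by `H x`.
open Classical in
omit [AddCommGroup Y] in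
theorem sum_sum_ite_apply_eq (k : Y → QueryTree X Y V) (x : X) (ψ : (X → Y) → ℂ) (P : V → Prop) :
    (∑ y, ∑ H : X → Y, if P ((k y).eval H) then ‖if H x = y then ψ H else 0‖ ^ 2 else 0) =
      ∑ H : X → Y, if P ((k (H x)).eval H) then ‖ψ H‖ ^ 2 else 0 := by
  rw [Finset.sum_comm]
  refine Finset.sum_congr rfl fun H _ => ?_
  rw [Finset.sum_eq_single (H x) (by intro y _ h; simp [h.symm]) (by simp), if_pos rfl]

-- Each query projects the purified state, and at a leaf the isometry property removes `compress`,
-- as the event ignores the database.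
open Classical in
theorem QueryTree.prob_compressedOracle (t : QueryTree X Y V) (ψ : (X → Y) → ℂ) (P : V → Prop) :
    t.prob (compressedOracle X Y) (compress ψ) (fun v _ => P v) =
      ∑ H : X → Y, if P (t.eval H) then ‖ψ H‖ ^ 2 else 0 := by
  induction t generalizing ψ with
  | out v =>
    simp only [QueryTree.prob, QueryTree.eval]
    by_cases h : P v
    · simpa [h] using sum_norm_sq_compress ψ
    · simp [h]
  | query x k ih =>
    simp only [QueryTree.prob, compressedOracle_classicalQuery, ih]
    exact sum_sum_ite_apply_eq k x ψ P

-- The induction carries the set `S` of points already queried and their recorded answers `a`. The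
-- exponent allows two factors for each recorded point and for each query still possible; a repeated
-- query does not enlarge `S`, whence only an inequality.
open Classical in
theorem QueryTree.le_prob_evalDB_of_agree (t : QueryTree X Y V) (S : Finset X) (a : X → Y)
    {ψ : (X → Y) → ℂ} (hψ : ∀ H, (∃ x ∈ S, H x ≠ a x) → ψ H = 0) (P : V → Prop) :
    (1 - 1 / (Fintype.card Y : ℝ)) ^ (2 * (S.card + t.depth)) *
        ∑ H : X → Y, (if P (t.eval H) then ‖ψ H‖ ^ 2 else 0) ≤
      t.prob (compressedOracle X Y) (compress ψ)
        (fun v D => (∀ x ∈ S, D x = some (a x)) ∧ t.evalDB D = some v ∧ P v) := by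
  have hN : (1 : ℝ) ≤ Fintype.card Y := Nat.one_le_cast.mpr Fintype.card_pos
  have h0 : 0 ≤ 1 - 1 / (Fintype.card Y : ℝ) := sub_nonneg.mpr ((div_le_one (by linarith)).mpr hN)
  have h1 : 1 - 1 / (Fintype.card Y : ℝ) ≤ 1 := sub_le_self _ (by positivity)
  induction t generalizing S a ψ with
  | out v =>
    simp only [QueryTree.prob, QueryTree.eval, QueryTree.depth, QueryTree.evalDB, true_and,
      add_zero]
    by_cases h : P v
    · simp only [h, and_true, if_true]
      exact (sum_norm_sq_compress_agree a S hψ).ge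
    · simp [h]
  | query x k ih =>
    simp only [QueryTree.prob, compressedOracle_classicalQuery]
    refine le_trans (le_of_eq (congrArg _ (sum_sum_ite_apply_eq k x ψ P).symm)) ?_
    rw [Finset.mul_sum]
    refine Finset.sum_le_sum fun y _ => ?_
    have hd := QueryTree.depth_lt x k y
    -- An answer contradicting an earlier one has amplitude zero.
    by_cases hx : x ∈ S ∧ y ≠ a x
    · rw [Finset.sum_eq_zero, mul_zero]
      · exact QueryTree.prob_nonneg _ _ _ _
      · intro H _
        by_cases h : H x = y
        · rw [if_pos h, hψ H ⟨x, hx.1, h ▸ hx.2⟩]; simp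
        · simp [h]
    have hxS : x ∈ S → y = a x := fun h => by_contra fun h' => hx ⟨h, h'⟩
    have hψ' : ∀ H : X → Y, (∃ x' ∈ insert x S, H x' ≠ Function.update a x y x') →
        (if H x = y then ψ H else 0) = 0 := by
      rintro H ⟨x', hx', h⟩
      by_cases hxx : x' = x
      · subst hxx
        rw [if_neg (by simpa using h)]
      · rw [Function.update_of_ne hxx] at h
        rw [hψ H ⟨x', Finset.mem_of_mem_insert_of_ne hx' hxx, h⟩, ite_self]
    refine le_trans ?_ ((ih y (insert x S) (Function.update a x y) hψ').trans
      (QueryTree.prob_mono _ _ _ ?_))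
    · refine mul_le_mul_of_nonneg_right (pow_le_pow_of_le_one h0 h1 ?_)
        (Finset.sum_nonneg fun H _ => by split_ifs <;> positivity)
      have := Finset.card_insert_le x S
      omega
    · rintro v D ⟨hD, hv, hP⟩
      have hDx : D x = some y := by simpa using hD x (Finset.mem_insert_self x S)
      refine ⟨fun x' hx' => ?_, ?_, hP⟩
      · by_cases hxx : x' = x
        · subst hxx; rw [hDx, hxS hx']
        · rw [hD x' (Finset.mem_insert_of_mem hx'), Function.update_of_ne hxx]
      · simpa [QueryTree.evalDB, hDx] using hv

/-- The database answers the queries of a classical algorithm in the same way as the compressed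
oracle did, up to a relative error `2 * ℓ / |Y|`. -/
theorem QueryTree.le_prob_evalDB (t : QueryTree X Y V) {ℓ : ℕ} (ht : t.depth ≤ ℓ)
    (ψ : (X → Y) → ℂ) (P : V → Prop) :
    (1 - 2 * (ℓ : ℝ) / Fintype.card Y) *
        t.prob (compressedOracle X Y) (compress ψ) (fun v _ => P v) ≤
      t.prob (compressedOracle X Y) (compress ψ) (fun v D => t.evalDB D = some v ∧ P v) := by
  have hN : (1 : ℝ) ≤ Fintype.card Y := Nat.one_le_cast.mpr Fintype.card_pos
  have hN' : 1 / (Fintype.card Y : ℝ) ≤ 1 := (div_le_one (by linarith)).mpr hN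
  -- Nothing is recorded at the start, so the assignment `0` is arbitrary.
  have h := t.le_prob_evalDB_of_agree ∅ (fun _ => 0) (ψ := ψ) (by simp) P
  rw [← QueryTree.prob_compressedOracle] at h
  simp only [Finset.card_empty, zero_add, Finset.notMem_empty, false_imp_iff, implies_true,
    true_and] at h
  refine le_trans (mul_le_mul_of_nonneg_right ?_ (QueryTree.prob_nonneg _ _ _ _)) h
  -- Bernoulli's inequality turns the power into a bound linear in the number of queries.
  have hB := one_add_mul_le_pow (a := -(1 / (Fintype.card Y : ℝ))) (by linarith) (2 * t.depth)
  rw [← sub_eq_add_neg] at hB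
  refine le_trans ?_ hB
  have : (t.depth : ℝ) ≤ ℓ := Nat.cast_le.mpr ht
  have h2 : 2 * (t.depth : ℝ) / Fintype.card Y ≤ 2 * (ℓ : ℝ) / Fintype.card Y := by gcongr
  push_cast
  rw [mul_neg, mul_one_div]
  linarith

end
-- Joint runs of quantum and classical algorithms
section
variable {X Y Z V E : Type*} [Fintype X] [DecidableEq X] [Fintype Y] [DecidableEq Y]
  [AddCommGroup Y] [Fintype E]

omit [AddCommGroup Y] in
theorem compress_sum {ι : Type*} (s : Finset ι) (a : ι → ℂ)
    (ψ : ι → (X → Y) → ℂ) (D : Database X Y) :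
    compress (fun H => ∑ t ∈ s, a t * ψ t H) D = ∑ t ∈ s, a t * compress (ψ t) D := by
  simp only [compress, Finset.mul_sum]
  rw [Finset.sum_comm]
  exact Finset.sum_congr rfl fun _ _ => Finset.sum_congr rfl fun _ _ => by ring

/-- The amplitude of the uniform superposition of all functions `X → Y`. -/
noncomputable def uniformAmplitude (X Y : Type*) [Fintype X] [Fintype Y] : ℂ :=
  ∏ _x : X, 1 / (Real.sqrt (Fintype.card Y) : ℂ)

-- The uniform superposition is `|0̂⟩` in every register, and `Comp` maps each factor to `|⊥⟩`.
omit [AddCommGroup Y] in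
theorem compress_uniform [Nonempty Y] (D : Database X Y) :
    compress (fun _ : X → Y => uniformAmplitude X Y) D = if D = fun _ => none then 1 else 0 := by
  simp only [compress, uniformAmplitude, ← Finset.prod_mul_distrib]
  rw [← Fintype.prod_sum (fun x u => compMatrix Y (D x) (some u) *
    (1 / (Real.sqrt (Fintype.card Y) : ℂ)))]
  simp only [sum_compMatrix_some, Fintype.prod_ite_zero, Finset.prod_const_one, funext_iff]

omit [DecidableEq Y] [AddCommGroup Y] in
theorem norm_uniformAmplitude_sq :
    ‖uniformAmplitude X Y‖ ^ 2 = 1 / (Fintype.card (X → Y) : ℝ) := by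
  rw [uniformAmplitude, Finset.prod_const, norm_pow, norm_div, norm_one, Complex.norm_real,
    Real.norm_eq_abs, pow_right_comm, div_pow, sq_abs, Real.sq_sqrt (Nat.cast_nonneg _), one_pow,
    div_pow, one_pow, Fintype.card_fun, Nat.cast_pow, Finset.card_univ]

/-- Queries are intertwined by `compressedOracle_applyQuery`; the local unitaries commute with
`compress` because it is linear and acts only on the oracle register. -/
theorem foldl_compressedOracle {d : ℕ} (L : List (Matrix.unitaryGroup (X × Y × Fin d) ℂ))
    (ψ : (X → Y) → X × Y × Fin d → Unit → ℂ) :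
    L.foldl (fun φ U => applyLocal U.1 ((compressedOracle X Y).applyQuery φ))
        (fun s => compress fun H => ψ H s ()) =
      fun s => compress fun H =>
        L.foldl (fun φ U => applyLocal U.1 ((standardOracle H).applyQuery φ)) (ψ H) s () := by
  induction L generalizing ψ with
  | nil => rfl
  | cons U L ih =>
    simp only [List.foldl_cons]
    rw [compressedOracle_applyQuery, ← ih]
    congr 1
    funext s D
    exact (compress_sum Finset.univ _ _ D).symm

omit [Fintype E] in
theorem applyLocal_smul {S : Type*} [Fintype S] (U : Matrix S S ℂ) (c : ℂ) (φ : S → E → ℂ) :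
    applyLocal U (c • φ) = c • applyLocal U φ := by
  funext s e
  simp only [applyLocal, Pi.smul_apply, smul_eq_mul, Finset.mul_sum]
  exact Finset.sum_congr rfl fun _ _ => by ring

omit [DecidableEq X] [DecidableEq Y] [AddCommGroup Y] in
theorem QOracle.applyQuery_smul (O : QOracle X Y E) {d : ℕ} (c : ℂ)
    (φ : X × Y × Fin d → E → ℂ) : O.applyQuery (c • φ) = c • O.applyQuery φ := by
  funext s e
  simp only [QOracle.applyQuery, Pi.smul_apply, smul_eq_mul, Finset.mul_sum]
  exact Finset.sum_congr rfl fun _ _ => by ring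

omit [AddCommGroup Y] in
theorem QOracle.foldl_smul (O : QOracle X Y E) {d : ℕ}
    (L : List (Matrix.unitaryGroup (X × Y × Fin d) ℂ)) (c : ℂ) (φ : X × Y × Fin d → E → ℂ) :
    L.foldl (fun φ U => applyLocal U.1 (O.applyQuery φ)) (c • φ) =
      c • L.foldl (fun φ U => applyLocal U.1 (O.applyQuery φ)) φ := by
  induction L generalizing φ with
  | nil => rfl
  | cons U L ih => rw [List.foldl_cons, List.foldl_cons, O.applyQuery_smul, applyLocal_smul, ih]

/-- The joint state of an algorithm and the compressed oracle is the compression of its joint state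
with the purified random oracle. -/
theorem OracleAlg.finalState_compressedOracle (A : OracleAlg X Y Z) (s : X × Y × Fin A.dim) :
    A.finalState (compressedOracle X Y) s = compress fun H =>
      uniformAmplitude X Y * A.finalState (standardOracle H) s () := by
  have h0 : (fun (s : X × Y × Fin A.dim) (D : Database X Y) =>
      A.init s * (compressedOracle X Y).init D) = fun s => compress fun H =>
        (uniformAmplitude X Y •
          fun (s : X × Y × Fin A.dim) (e : Unit) => A.init s * (standardOracle H).init e) s () := by
    funext s D
    have h1 := compress_sum {()} (fun _ => A.init s)
      (fun _ (_ : X → Y) => uniformAmplitude X Y) D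
    simp only [Finset.sum_singleton, compress_uniform] at h1
    simp only [compressedOracle, ← h1, standardOracle, Pi.smul_apply, smul_eq_mul, mul_one]
    congr 1
    funext H
    ring
  rw [OracleAlg.finalState, h0, foldl_compressedOracle]
  simp only [QOracle.foldl_smul]
  rfl

theorem sum_norm_sq_applyLocal {S : Type*} [Fintype S] [DecidableEq S]
    (U : Matrix.unitaryGroup S ℂ) (φ : S → Unit → ℂ) :
    ∑ s, ‖applyLocal U.1 φ s ()‖ ^ 2 = ∑ s, ‖φ s ()‖ ^ 2 := by
  have key (v : S → ℂ) : ((∑ s, ‖v s‖ ^ 2 : ℝ) : ℂ) = star v ⬝ᵥ v := by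
    rw [Complex.ofReal_sum, dotProduct]
    refine Finset.sum_congr rfl fun s _ => ?_
    rw [← Complex.normSq_eq_norm_sq, Complex.normSq_eq_conj_mul_self]
    rfl
  apply Complex.ofReal_injective
  rw [key, key]
  have : (fun s => applyLocal U.1 φ s ()) = U.1.mulVec fun s => φ s () := rfl
  rw [this, Matrix.star_mulVec, ← Matrix.dotProduct_mulVec, Matrix.mulVec_mulVec,
    ← Matrix.star_eq_conjTranspose, Matrix.UnitaryGroup.star_mul_self, Matrix.one_mulVec]

theorem OracleAlg.sum_norm_sq_finalState_standardOracle (A : OracleAlg X Y Z) (H : X → Y) :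
    ∑ s, ‖A.finalState (standardOracle H) s ()‖ ^ 2 = 1 := by
  have key (L : List (Matrix.unitaryGroup (X × Y × Fin A.dim) ℂ))
      (φ : X × Y × Fin A.dim → Unit → ℂ) :
      ∑ s, ‖L.foldl (fun φ U => applyLocal U.1 ((standardOracle H).applyQuery φ)) φ s ()‖ ^ 2 =
        ∑ s, ‖φ s ()‖ ^ 2 := by
    induction L generalizing φ with
    | nil => rfl
    | cons U L ih =>
      rw [List.foldl_cons, ih, sum_norm_sq_applyLocal]
      simp only [standardOracle_applyQuery, Fintype.sum_prod_type]
      refine Finset.sum_congr rfl fun x _ => ?_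
      -- For fixed `H`, a query only permutes the basis, translating the response by `H x`.
      exact (Equiv.subRight (H x)).sum_comp fun y => ∑ w, ‖φ (x, y, w) ()‖ ^ 2
  rw [OracleAlg.finalState, key]
  simpa [standardOracle] using A.init_norm

theorem compProb_nonneg (O : QOracle X Y E) (A : OracleAlg X Y Z) (F : ClassicalAlg X Y Z V)
    (ev : Fin F.coins → Z → V → E → Prop) : 0 ≤ compProb O A F ev :=
  Finset.sum_nonneg fun _ _ => mul_nonneg ENNReal.toReal_nonneg
    (Finset.sum_nonneg fun _ _ => QueryTree.prob_nonneg _ _ _ _)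

theorem compProb_mono (O : QOracle X Y E) (A : OracleAlg X Y Z) (F : ClassicalAlg X Y Z V)
    {ev ev' : Fin F.coins → Z → V → E → Prop} (h : ∀ r z v e, ev r z v e → ev' r z v e) :
    compProb O A F ev ≤ compProb O A F ev' :=
  Finset.sum_le_sum fun _ _ => mul_le_mul_of_nonneg_left
    (Finset.sum_le_sum fun _ _ => QueryTree.prob_mono _ _ _ (h _ _)) ENNReal.toReal_nonneg

/-- The database answers the queries of `F` in the same way as the compressed oracle did, up to a
relative error `2 * ℓ / |Y|`. -/
theorem le_compProb_evalDB (A : OracleAlg X Y Z) (F : ClassicalAlg X Y Z V) {ℓ : ℕ}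
    (hF : ∀ r z, (F.tree r z).depth ≤ ℓ) (P : Z → V → Prop) :
    (1 - 2 * (ℓ : ℝ) / Fintype.card Y) *
        compProb (compressedOracle X Y) A F (fun _ z v _ => P z v) ≤
      compProb (compressedOracle X Y) A F
        (fun r z v D => (F.tree r z).evalDB D = some v ∧ P z v) := by
  simp only [compProb]
  rw [Finset.mul_sum]
  refine Finset.sum_le_sum fun r _ => ?_
  rw [mul_left_comm]
  refine mul_le_mul_of_nonneg_left ?_ ENNReal.toReal_nonneg
  rw [Finset.mul_sum]
  refine Finset.sum_le_sum fun s _ => ?_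
  rw [A.finalState_compressedOracle]
  exact QueryTree.le_prob_evalDB _ (hF _ _) _ (P (A.out s))

theorem le_compCondProb_evalDB (A : OracleAlg X Y Z) (F : ClassicalAlg X Y Z V) {ℓ : ℕ}
    (hF : ∀ r z, (F.tree r z).depth ≤ ℓ) (P : Z → V → Prop)
    (hP : compProb (compressedOracle X Y) A F (fun _ z v _ => P z v) ≠ 0) :
    1 - 2 * (ℓ : ℝ) / Fintype.card Y ≤ compCondProb (compressedOracle X Y) A F
      (fun r z v D => (F.tree r z).evalDB D = some v) (fun _ z v _ => P z v) :=
  (le_div_iff₀ (lt_of_le_of_ne (compProb_nonneg _ _ _ _) hP.symm)).mpr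
    (le_compProb_evalDB A F hF P)

/-- For events that do not depend on the internal state of the oracle, the compressed oracle is
indistinguishable from the standard random oracle. -/
theorem compProb_compressedOracle (A : OracleAlg X Y Z) (F : ClassicalAlg X Y Z V)
    (P : Z → V → Prop) :
    compProb (compressedOracle X Y) A F (fun _ z v _ => P z v) =
      (∑ H : X → Y, compProb (standardOracle H) A F (fun _ z v _ => P z v)) /
        Fintype.card (X → Y) := by
  simp only [compProb, A.finalState_compressedOracle, QueryTree.prob_compressedOracle,
    QueryTree.prob_standardOracle, norm_mul, mul_pow, norm_uniformAmplitude_sq]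
  rw [Finset.sum_comm, Finset.sum_div]
  refine Finset.sum_congr rfl fun r _ => ?_
  rw [← Finset.mul_sum, mul_div_assoc, Finset.sum_comm, Finset.sum_div]
  congr 1
  refine Finset.sum_congr rfl fun s _ => ?_
  rw [Finset.sum_div]
  refine Finset.sum_congr rfl fun H _ => ?_
  rw [ite_div, zero_div, one_div_mul_eq_div]

open Classical in
theorem compProb_standardOracle_queryPoints {ℓ : ℕ} (A : OracleAlg X Y ((Fin ℓ → X) × Z))
    (H : X → Y) (P : (Fin ℓ → X) × Z → (Fin ℓ → Y) → Prop) :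
    compProb (standardOracle H) A (ClassicalAlg.queryPoints X Y Z ℓ) (fun _ xz y _ => P xz y) =
      A.prob (standardOracle H) fun xz _ => P xz (H ∘ xz.1) := by
  change ∑ r : Fin 1, ((PMF.pure 0 : PMF (Fin 1)) r).toReal * ∑ s, (queryAll (A.out s).1).prob
    (standardOracle H) (A.finalState (standardOracle H) s) (fun y _ => P (A.out s) y) = _
  simp only [QueryTree.prob_standardOracle, eval_queryAll, OracleAlg.prob]
  simp

theorem OracleAlg.prob_standardOracle_le_one (A : OracleAlg X Y Z) (H : X → Y)
    (ev : Z → Unit → Prop) : A.prob (standardOracle H) ev ≤ 1 := by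
  rw [← A.sum_norm_sq_finalState_standardOracle H]
  refine Finset.sum_le_sum fun s _ => ?_
  rw [Finset.univ_unique, Finset.sum_singleton]
  split_ifs
  · exact le_rfl
  · positivity

end

/-! ### Comparison of the success probabilities -/

section
variable {X Y Z : Type*} [Fintype X] [DecidableEq X] [Fintype Y] [DecidableEq Y] [AddCommGroup Y]
  {ℓ : ℕ} (A : OracleAlg X Y ((Fin ℓ → X) × Z)) (R : Set ((Fin ℓ → X) × (Fin ℓ → Y) × Z))

theorem pTilde_eq_pCirc : pTilde A R = pCirc A R := by
  simp only [pTilde, pCirc]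
  congr 1
  refine Finset.sum_congr rfl fun H _ => ?_
  rw [compProb_standardOracle_queryPoints A H (fun xz y => y = H ∘ xz.1 ∧ (xz.1, y, xz.2) ∈ R)]
  simp only [true_and]

theorem pCirc_eq_compProb_compressedOracle :
    pCirc A R = compProb (compressedOracle X Y) A (ClassicalAlg.queryPoints X Y Z ℓ)
      (fun _ xz y _ => (xz.1, y, xz.2) ∈ R) := by
  rw [compProb_compressedOracle A _ (fun xz y => (xz.1, y, xz.2) ∈ R), pCirc]
  simp only [compProb_standardOracle_queryPoints A _ (fun xz y => (xz.1, y, xz.2) ∈ R)]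

theorem pCirc_le_one : pCirc A R ≤ 1 := by
  rw [pCirc, div_le_one (Nat.cast_pos.mpr Fintype.card_pos)]
  refine (Finset.sum_le_card_nsmul _ _ 1 fun H _ => A.prob_standardOracle_le_one H _).trans ?_
  simp

theorem pPrimeTilde_eq_compProb_evalDB :
    pPrimeTilde A R = compProb (compressedOracle X Y) A (ClassicalAlg.queryPoints X Y Z ℓ)
      (fun r xz y D => ((ClassicalAlg.queryPoints X Y Z ℓ).tree r xz).evalDB D = some y ∧
        (xz.1, y, xz.2) ∈ R) := by
  simp only [pPrimeTilde, ClassicalAlg.queryPoints, evalDB_queryAll]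

theorem pCirc_le_pPrimeTilde_add :
    pCirc A R ≤ pPrimeTilde A R + 2 * (ℓ : ℝ) / Fintype.card Y := by
  have h := le_compProb_evalDB A (ClassicalAlg.queryPoints X Y Z ℓ)
    (fun _ xz => depth_queryAll_le xz.1) (fun xz y => (xz.1, y, xz.2) ∈ R)
  rw [← pCirc_eq_compProb_compressedOracle, ← pPrimeTilde_eq_compProb_evalDB] at h
  -- The relative error becomes additive because `pCirc A R ≤ 1`.
  have h1 : 2 * (ℓ : ℝ) / Fintype.card Y * pCirc A R ≤ 2 * (ℓ : ℝ) / Fintype.card Y :=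
    mul_le_of_le_one_right (by positivity) (pCirc_le_one A R)
  linarith

theorem pPrimeTilde_le_pDatabase : pPrimeTilde A R ≤ pDatabase A R :=
  compProb_mono _ _ _ fun _ _ y _ h => ⟨y, h⟩

end

theorem mainTheorem7 {X Y Z V : Type*} [Fintype X] [DecidableEq X] [Fintype Y] [DecidableEq Y]
    [AddCommGroup Y] (ℓ : ℕ) :
    -- conditioned on the output `(x, y, z)` of `Ã`, the database satisfies `y = D(x)`
    (∀ (A : OracleAlg X Y ((Fin ℓ → X) × Z)) (x : Fin ℓ → X) (y : Fin ℓ → Y) (z : Z),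
      compProb (compressedOracle X Y) A (ClassicalAlg.queryPoints X Y Z ℓ)
          (fun _ xz' y' _ => xz' = (x, z) ∧ y' = y) ≠ 0 →
      1 - 2 * (ℓ : ℝ) / (Fintype.card Y : ℝ) ≤
        compCondProb (compressedOracle X Y) A (ClassicalAlg.queryPoints X Y Z ℓ)
          (fun _ xz' y' D => ∀ i, D (xz'.1 i) = some (y' i))
          (fun _ xz' y' _ => xz' = (x, z) ∧ y' = y)) ∧
    -- the same for an arbitrary classical `ℓ`-query algorithm `F` run on the output of `A`
    (∀ (A : OracleAlg X Y Z) (F : ClassicalAlg X Y Z V), (∀ r z, (F.tree r z).depth ≤ ℓ) →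
      ∀ (v : V) (z : Z),
      compProb (compressedOracle X Y) A F (fun _ z' v' _ => z' = z ∧ v' = v) ≠ 0 →
      1 - 2 * (ℓ : ℝ) / (Fintype.card Y : ℝ) ≤
        compCondProb (compressedOracle X Y) A F
          (fun r z' v' D => (F.tree r z').evalDB D = some v')
          (fun _ z' v' _ => z' = z ∧ v' = v)) ∧
    -- the comparison of the success probabilities
    (∀ (A : OracleAlg X Y ((Fin ℓ → X) × Z)) (R : Set ((Fin ℓ → X) × (Fin ℓ → Y) × Z)),
      pCirc A R = pTilde A R ∧
      pTilde A R ≤ pPrimeTilde A R + 2 * (ℓ : ℝ) / (Fintype.card Y : ℝ) ∧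
      pPrimeTilde A R ≤ pDatabase A R) := by
  refine ⟨fun A x y z h => ?_, fun A F hF v z h => ?_, fun A R => ⟨(pTilde_eq_pCirc A R).symm,
    (pTilde_eq_pCirc A R).trans_le (pCirc_le_pPrimeTilde_add A R), pPrimeTilde_le_pDatabase A R⟩⟩
  · have := le_compCondProb_evalDB A (ClassicalAlg.queryPoints X Y Z ℓ)
      (fun _ xz => depth_queryAll_le xz.1) (fun xz' y' => xz' = (x, z) ∧ y' = y) h
    simpa only [ClassicalAlg.queryPoints, evalDB_queryAll] using this
  · exact le_compCondProb_evalDB A F hF (fun z' v' => z' = z ∧ v' = v) h
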